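/- Let $\mathcal S_n$ be the set of permutations $\sigma=a_1a_2\cdots a_n$ of $\{1,\dots,n\}$. For a classical pattern $\pi\in\mathcal S_3$, let $\mathcal S_n(\pi)$ be the set of $\sigma\in\mathcal S_n$ that avoid $\pi$, i.e. have no subsequence $a_{i_1}a_{i_2}a_{i_3}$ ($i_1<i_2<i_3$) in the same relative order as $\pi$. Let $\mathrm{inv}(\sigma)$ be the number of pairs $i<j$ with $a_i>a_j$, and let $$\mathrm{mad}(\sigma)=2\cdot(2\underline{31})\sigma+(\underline{31}2)\sigma+(\underline{21})\sigma ,$$ where $(2\underline{31})\sigma$ is the number of pairs $(i,j)$ with $i<j<n$ and $a_{j+1}<a_i<a_j$, $(\underline{31}2)\sigma$ is the number of pairs $(j,k)$ with $j+1<k\le n$ and $a_{j+1}<a_k<a_j$, and $(\underline{21})\sigma$ is the number of descents of $\sigma$, i.e. of indices $j<n$ with $a_j>a_{j+1}$. Then for every $n\ge 0$ the distribution of $\mathrm{mad}$ over $\mathcal S_n(231)$ equals the distribution of $\mathrm{inv}$ over $\mathcal S_n(321)$: $$\sum_{\sigma\in\mathcal S_n(231)}q^{\mathrm{mad}(\sigma)}=\sum_{\sigma\in\mathcal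 S_n(321)}q^{\mathrm{inv}(\sigma)} .$$ Equivalently, there is a bijection $\phi:\mathcal S_n(321)\to\mathcal S_n(231)$ with $\mathrm{mad}(\phi(\sigma))=\mathrm{inv}(\sigma)$ for all $\sigma\in\mathcal S_n(321)$. -/

import Mathlib

open Polynomial

namespace PatternStat

/-- A permutation `σ = a₁ ⋯ aₙ` is an `Equiv.Perm (Fin n)`, the letter `k ∈ {1, …, n}` being
represented by `k - 1 : Fin n`. A vincular pattern is a word `w = w₁ ⋯ wₘ` of distinct numbers
together with a set `A` of adjacencies: `j ∈ A` means that `wⱼ` and `wⱼ₊₁` are underlined, i.e. have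
to be matched by neighbouring entries. `A = ∅` gives the classical pattern `w`.

`IsOccurrence w A σ i` says that the positions `i₁ < ⋯ < iₘ` form an occurrence of `(w, A)` in `σ`:
the subword of `σ` at these positions is order-isomorphic to `w`, and `iⱼ₊₁ = iⱼ + 1` for `j ∈ A`. -/
def IsOccurrence {m n : ℕ} (w : Fin m → ℕ) (A : Finset ℕ) (σ : Equiv.Perm (Fin n))
    (i : Fin m → Fin n) : Prop :=
  (∀ j k : Fin m, j < k → i j < i k) ∧
  (∀ j k : Fin m, σ (i j) < σ (i k) ↔ w j < w k) ∧
  (∀ j k : Fin m, (k : ℕ) = (j : ℕ) + 1 → (j : ℕ) + 1 ∈ A → (i k : ℕ) = (i j : ℕ) + 1)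

instance instDecidableIsOccurrence {m n : ℕ} (w : Fin m → ℕ) (A : Finset ℕ)
    (σ : Equiv.Perm (Fin n)) (i : Fin m → Fin n) : Decidable (IsOccurrence w A σ i) := by
  unfold IsOccurrence
  infer_instance

/-- The number of occurrences of the vincular pattern `(w, A)` in `σ`. -/
def occ {m n : ℕ} (w : Fin m → ℕ) (A : Finset ℕ) (σ : Equiv.Perm (Fin n)) : ℕ :=
  (Finset.univ.filter (fun i : Fin m → Fin n => IsOccurrence w A σ i)).card

/-- The set of permutations of `n` letters that avoid the classical pattern `w`. -/
def avoiding {m : ℕ} (n : ℕ) (w : Fin m → ℕ) : Finset (Equiv.Perm (Fin n)) :=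
  Finset.univ.filter (fun σ => ∀ i : Fin m → Fin n, ¬ IsOccurrence w ∅ σ i)

/-- The number of inversions. -/
def inv {n : ℕ} (σ : Equiv.Perm (Fin n)) : ℕ :=
  (Finset.univ.filter (fun p : Fin n × Fin n => p.1 < p.2 ∧ σ p.2 < σ p.1)).card

/-- The statistic `mad`: the sum of the vincular pattern statistics `2-31`, `2-31`, `31-2`
and `21`, where the neighbouring letters `31`, resp. `21`, are required to be adjacent. -/
def mad {n : ℕ} (σ : Equiv.Perm (Fin n)) : ℕ :=
  occ ![2, 3, 1] {2} σ + occ ![2, 3, 1] {2} σ + occ ![3, 1, 2] {1} σ + occ ![2, 1] {1} σ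

end PatternStat

namespace PatternStat

/-! ### Generating function of the `321`-avoiding tree. -/

section Series

variable {R : Type*} [CommRing R] (q : R)

/-! Both classes grow by appending a last letter, and a small state records what may be appended and
at what cost. If the `l` largest letters of a `321`-avoider increase, `l` maximal, it may receive a
new maximum (weight `1`, new label `l + 1`) or a letter with `j` letters above it, `1 ≤ j ≤ l`
(weight `q ^ j`, new label `j`). For a `231`-avoider the decreasing top letters play this role.
There `2-31` never occurs, so `mad` grows by the number of runs of positions filled by letters not
below the new one; the state is the list of these run counts (`runList_spec`).

The two trees are compared through generating functions. Let `I_l(x)` be the series of label `l`, `I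
= I_0` and `r = I_1 / I_0`. The three-term recurrence of the `I_l` yields `I = 1 + x r I` and `r = 1
+ q x I(qx) r` (`exists_labelSeries_functional`). By these two equations alone, an explicit product
over the entries of a state solves the recurrence of the second tree, with value `I` at the empty
state (`stackSeries_eq`). The bijection then matches fibres of equal size. -/

/-- Weighted count of the words of length `n` read from label `l` in the generating tree of the
`321`-avoiding permutations: a label `l` has a child `l + 1` of weight `1` and children
`1, …, l`, the child `j` having weight `q ^ j`. -/
def labelSum : ℕ → ℕ → R
  | 0, _ => 1
  | n + 1, l => labelSum n (l + 1) + ∑ j ∈ Finset.range l, q ^ (j + 1) * labelSum n (j + 1)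

/-- The generating function of `labelSum`. -/
def labelSeries (l : ℕ) : PowerSeries R := PowerSeries.mk fun n => labelSum q n l

lemma labelSeries_zero : labelSeries q 0 = 1 + PowerSeries.X * labelSeries q 1 := by
  ext (_ | n)
  · simp [labelSeries, labelSum]
  · rw [map_add, PowerSeries.coeff_succ_X_mul]
    simp [labelSeries, labelSum, PowerSeries.coeff_one]

/-- Subtracting the recursions at `l + 1` and `l` leaves only one summand of the sum over smaller
labels. -/
lemma labelSeries_succ (l : ℕ) :
    labelSeries q (l + 1) = labelSeries q l + PowerSeries.X *
      (labelSeries q (l + 2) - labelSeries q (l + 1)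
        + PowerSeries.C (q ^ (l + 1)) * labelSeries q (l + 1)) := by
  ext (_ | n)
  · simp [labelSeries, labelSum]
  · rw [map_add, PowerSeries.coeff_succ_X_mul]
    simp only [map_add, map_sub, PowerSeries.coeff_C_mul]
    simp only [labelSeries, PowerSeries.coeff_mk, labelSum, Finset.sum_range_succ]
    ring

lemma exists_labelSeries_ratio :
    ∃ W : ℕ → PowerSeries R, ∀ l, labelSeries q (l + 1) = (1 + W l) * labelSeries q l := by
  have h (l : ℕ) : IsUnit (labelSeries q l) := by
    rw [PowerSeries.isUnit_iff_constantCoeff, ← PowerSeries.coeff_zero_eq_constantCoeff_apply]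
    simp [labelSeries, labelSum]
  choose U hU using fun l => (h l).exists_left_inv
  refine ⟨fun l => labelSeries q (l + 1) * U l - 1, fun l => ?_⟩
  linear_combination (-labelSeries q (l + 1)) * hU l

lemma rescale_X_eq : PowerSeries.rescale q (PowerSeries.X : PowerSeries R)
    = PowerSeries.C q * PowerSeries.X := PowerSeries.rescale_X q

lemma rescale_C_eq (a : R) :
    PowerSeries.rescale q (PowerSeries.C a) = PowerSeries.C a := by
  ext n
  rw [PowerSeries.coeff_rescale, PowerSeries.coeff_C]
  split_ifs with h <;> simp [h]

/-- If a family of series satisfies the recurrence of the ratios `F (l + 1) / F l - 1` of a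
three-term recurrence, each of its members satisfies a `q`-functional equation in `x`. -/
lemma functional_of_ratio (W : ℕ → PowerSeries R)
    (hW : ∀ l, W l = PowerSeries.X * (1 + W l) * (W (l + 1) + PowerSeries.C q ^ (l + 1))) (l : ℕ) :
    W l = PowerSeries.X * (PowerSeries.C q ^ (l + 1) + PowerSeries.C q * W l)
      + PowerSeries.X * W l *
        (PowerSeries.C q ^ (l + 1) + PowerSeries.C q * PowerSeries.rescale q (W l)) := by
  set x : PowerSeries R := PowerSeries.X
  set c : PowerSeries R := PowerSeries.C q with hc
  -- The defect of the claimed equation. It reproduces itself as `D l = x * (...) * D (l + 1)`, so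
  -- every power of `x` divides it and it vanishes.
  set D : ℕ → PowerSeries R := fun l => W l - x * (c ^ (l + 1) + c * W l)
    - x * W l * (c ^ (l + 1) + c * PowerSeries.rescale q (W l)) with hD
  have hstep (l : ℕ) :
      D l = x * ((1 + W l) * (1 + PowerSeries.rescale q (W l)) * D (l + 1)) := by
    have h1 := hW l
    have h2 := congrArg (PowerSeries.rescale q) (hW l)
    simp only [map_mul, map_add, map_one, map_pow, rescale_X_eq, rescale_C_eq, x, hc] at h2
    simp only [hD]
    generalize PowerSeries.rescale q (W l) = W' at *
    generalize PowerSeries.rescale q (W (l + 1)) = V' at *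
    generalize W l = w at *
    generalize W (l + 1) = v at *
    change W' = c * x * (1 + W') * (V' + c ^ (l + 1)) at h2
    have e : c ^ (l + 1 + 1) = c * c ^ (l + 1) := by ring
    rw [e]
    generalize c ^ (l + 1) = d at *
    linear_combination (1 - x * c * (1 + W')) * h1 - x * (1 + w) * v * h2
  have hdvd (n : ℕ) : ∀ l, x ^ n ∣ D l := by
    induction n with
    | zero => simp
    | succ n ih =>
      intro l
      rw [hstep l, pow_succ']
      exact mul_dvd_mul_left x ((ih (l + 1)).mul_left _)
  have h0 : D l = 0 := by
    ext n
    exact PowerSeries.X_pow_dvd_iff.1 (hdvd (n + 1) l) n n.lt_succ_self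
  simp only [hD] at h0
  linear_combination h0

/-- The two functional equations of the generating function of `321`-avoiding permutations by
inversions. -/
lemma exists_labelSeries_functional : ∃ r : PowerSeries R,
    labelSeries q 0 = 1 + PowerSeries.X * r * labelSeries q 0 ∧
    r = 1 + PowerSeries.C q * PowerSeries.X * PowerSeries.rescale q (labelSeries q 0) * r := by
  obtain ⟨W, hW⟩ := exists_labelSeries_ratio q
  have hu (l : ℕ) : IsUnit (labelSeries q l) := by
    rw [PowerSeries.isUnit_iff_constantCoeff, ← PowerSeries.coeff_zero_eq_constantCoeff_apply]
    simp [labelSeries, labelSum]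
  have hcol (l : ℕ) :
      W l = PowerSeries.X * (1 + W l) * (W (l + 1) + PowerSeries.C q ^ (l + 1)) := by
    have h1 := labelSeries_succ q l
    rw [hW (l + 1), hW l, map_pow] at h1
    -- The recurrence divided by the unit `I_l`.
    refine (hu l).mul_right_cancel ?_
    linear_combination h1
  have hI : labelSeries q 0 = 1 + PowerSeries.X * (1 + W 0) * labelSeries q 0 := by
    rw [mul_assoc, ← hW 0]
    exact labelSeries_zero q
  refine ⟨1 + W 0, hI, ?_⟩
  have hf := functional_of_ratio q W hcol 0
  have h2 := congrArg (PowerSeries.rescale q) hI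
  simp only [map_mul, map_add, map_one, rescale_X_eq] at h2
  rw [zero_add, pow_one] at hf
  generalize labelSeries q 0 = I at *
  generalize PowerSeries.rescale q I = I' at *
  generalize PowerSeries.rescale q (W 0) = W' at *
  -- Multiplying `hf` by `I(qx)` turns its quadratic term into `W 0 * (I(qx) - 1)` by `h2`; what
  -- remains is `W 0 = q x r I(qx)`.
  linear_combination I' * hf - W 0 * h2

/-! ### Product solution of the `231`-avoiding tree. -/

/-- Weighted count of the words of length `n` read from state `L` in the generating tree of the
`231`-avoiding permutations. -/
def stackSum : ℕ → List ℕ → R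
  | 0, _ => 1
  | n + 1, L => q ^ L.headD 0 * stackSum n (L.headD 1 :: L) +
      ∑ i ∈ Finset.range L.length,
        q ^ (L.drop (i + 1)).headD 0 *
          stackSum n (((L.drop (i + 1)).headD 0 + 1) :: L.drop (i + 1))

/-- The states of the generating tree of the `231`-avoiding permutations: from right to left, the
entries start with `1` and increase by `0` or `1`. -/
inductive IsState : List ℕ → Prop
  | nil : IsState []
  | single : IsState [1]
  | same (b : ℕ) (L : List ℕ) : IsState (b :: L) → IsState (b :: b :: L)
  | succ (b : ℕ) (L : List ℕ) : IsState (b :: L) → IsState ((b + 1) :: b :: L)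

lemma IsState.tail {a : ℕ} {L : List ℕ} (h : IsState (a :: L)) : IsState L := by
  cases h with
  | single => exact .nil
  | same _ _ h => exact h
  | succ _ _ h => exact h

lemma IsState.drop {L : List ℕ} (h : IsState L) (i : ℕ) : IsState (L.drop i) := by
  induction i generalizing L with
  | zero => exact h
  | succ i ih =>
    cases L with
    | nil => exact .nil
    | cons a L => exact ih h.tail

lemma IsState.repeat_head {L : List ℕ} (h : IsState L) : IsState (L.headD 1 :: L) := by
  cases L with
  | nil => exact .single
  | cons a L => exact .same a L h

lemma IsState.succ_head {L : List ℕ} (h : IsState L) : IsState ((L.headD 0 + 1) :: L) := by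
  cases L with
  | nil => exact .single
  | cons a L => exact .succ a L h

/-- The generating function of `stackSum` in product form. -/
noncomputable def stackSeries (I r : PowerSeries R) : List ℕ → PowerSeries R
  | [] => I
  | [_] => r * I
  | a :: b :: L => PowerSeries.rescale (q ^ b) (if a = b then I else I * (r + 1 - I)) *
      stackSeries I r (b :: L)

lemma stackSeries_same (I r : PowerSeries R) (b : ℕ) (L : List ℕ) :
    stackSeries q I r (b :: b :: L)
      = PowerSeries.rescale (q ^ b) I * stackSeries q I r (b :: L) := by
  simp [stackSeries]

lemma stackSeries_succ (I r : PowerSeries R) (b : ℕ) (L : List ℕ) :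
    stackSeries q I r ((b + 1) :: b :: L)
      = PowerSeries.rescale (q ^ b) (I * (r + 1 - I)) * stackSeries q I r (b :: L) := by
  simp [stackSeries]

/-- Subtracting the equation of the tail `M` from that of `a :: M` cancels all deeper sites.
Dividing out the factor of `M` leaves one identity in `I`, `r` and `I(qx)`, rescaled by `q ^ b` with
`b` the head of `M`: the first functional equation for a repeated head, a consequence of both for an
increased head. -/
lemma stackSeries_eq {I r : PowerSeries R} (h1 : I = 1 + PowerSeries.X * r * I)
    (h2 : r = 1 + PowerSeries.C q * PowerSeries.X * PowerSeries.rescale q I * r)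
    {L : List ℕ} (hL : IsState L) :
    stackSeries q I r L = 1 + PowerSeries.X *
      (PowerSeries.C (q ^ L.headD 0) * stackSeries q I r (L.headD 1 :: L) +
        ∑ i ∈ Finset.range L.length, PowerSeries.C (q ^ (L.drop (i + 1)).headD 0) *
          stackSeries q I r (((L.drop (i + 1)).headD 0 + 1) :: L.drop (i + 1))) := by
  induction hL with
  | nil => simpa [stackSeries, mul_assoc] using h1
  | single =>
    have : stackSeries q I r [1, 1] = PowerSeries.rescale q I * (r * I) := by
      simp [stackSeries]
    simp only [List.headD_cons, pow_one, this]
    simp [stackSeries]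
    linear_combination h1 + I * h2
  | same b L _ ih =>
    have e := congrArg (PowerSeries.rescale (q ^ b)) h1
    simp only [map_mul, map_add, map_one, rescale_X_eq] at e
    rw [List.length_cons, Finset.sum_range_succ']
    simp only [List.drop_succ_cons, List.drop_zero, List.headD_cons, stackSeries_same,
      stackSeries_succ] at ih ⊢
    simp only [map_mul, map_sub, map_add, map_one]
    generalize PowerSeries.rescale (q ^ b) I = J at *
    generalize PowerSeries.rescale (q ^ b) r = s at *
    linear_combination ih + stackSeries q I r (b :: L) * e
  | succ b L _ ih =>
    have e1 := congrArg (PowerSeries.rescale (q ^ b)) h1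
    have e2 := congrArg (PowerSeries.rescale (q ^ b)) h2
    have e3 : PowerSeries.rescale (q ^ (b + 1)) I
        = PowerSeries.rescale (q ^ b) (PowerSeries.rescale q I) := by
      rw [PowerSeries.rescale_rescale, pow_succ, mul_comm]
    simp only [map_mul, map_add, map_one, rescale_X_eq, rescale_C_eq] at e1 e2
    rw [List.length_cons, Finset.sum_range_succ']
    simp only [List.drop_succ_cons, List.drop_zero, List.headD_cons, stackSeries_same,
      stackSeries_succ, e3] at ih ⊢
    simp only [map_mul, map_sub, map_add, map_one, pow_succ]
    generalize PowerSeries.rescale (q ^ b) (PowerSeries.rescale q I) = K at *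
    generalize PowerSeries.rescale (q ^ b) I = J at *
    generalize PowerSeries.rescale (q ^ b) r = s at *
    generalize PowerSeries.C (q ^ b) = c at *
    generalize PowerSeries.C q = d at *
    generalize stackSeries q I r (b :: L) = g at *
    -- The identity left for an increased head, after division by `g`.
    have e4 : J * (s + 1 - J) - 1 = d * (c * PowerSeries.X) * K * (J * (s + 1 - J))
        - c * PowerSeries.X * J + c * PowerSeries.X * (J * (s + 1 - J)) := by
      generalize c * PowerSeries.X = y at *
      generalize d * y * K = Y at *
      linear_combination (1 - J * (1 - Y)) * e1 + (J - y * J ^ 2) * e2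
    linear_combination ih + g * e4

lemma coeff_stackSeries {I r : PowerSeries R} (h1 : I = 1 + PowerSeries.X * r * I)
    (h2 : r = 1 + PowerSeries.C q * PowerSeries.X * PowerSeries.rescale q I * r)
    (n : ℕ) {L : List ℕ} (hL : IsState L) :
    PowerSeries.coeff n (stackSeries q I r L) = stackSum q n L := by
  induction n generalizing L with
  | zero =>
    rw [stackSeries_eq q h1 h2 hL]
    simp [stackSum]
  | succ n ih =>
    rw [stackSeries_eq q h1 h2 hL, map_add, PowerSeries.coeff_succ_X_mul, map_add, map_sum]
    simp only [PowerSeries.coeff_C_mul]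
    rw [ih hL.repeat_head, stackSum, PowerSeries.coeff_one, if_neg n.succ_ne_zero, zero_add]
    congr 1
    refine Finset.sum_congr rfl fun i _ => ?_
    rw [ih (hL.drop (i + 1)).succ_head]

theorem stackSum_nil_eq_labelSum_zero (n : ℕ) : stackSum q n [] = labelSum q n 0 := by
  obtain ⟨r, h1, h2⟩ := exists_labelSeries_functional q
  rw [← coeff_stackSeries q h1 h2 n .nil]
  simp [stackSeries, labelSeries]

end Series

/-! ### Appending a last letter. -/

/-- Append the letter `a` to `τ`, raising the letters of `τ` that are at least `a`. -/
noncomputable def append {n : ℕ} (a : Fin (n + 1)) (τ : Equiv.Perm (Fin n)) : Equiv.Perm (Fin (n + 1)) :=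
  Equiv.ofBijective (Fin.lastCases a fun i => a.succAbove (τ i)) <| by
    rw [← Finite.injective_iff_bijective]
    intro i j
    induction i using Fin.lastCases <;> induction j using Fin.lastCases <;>
      simp [Fin.succAbove_ne, (Fin.succAbove_ne _ _).symm]

@[simp] lemma append_last {n : ℕ} (a : Fin (n + 1)) (τ : Equiv.Perm (Fin n)) :
    append a τ (Fin.last n) = a := by
  simp [append]

@[simp] lemma append_castSucc {n : ℕ} (a : Fin (n + 1)) (τ : Equiv.Perm (Fin n)) (i : Fin n) :
    append a τ i.castSucc = a.succAbove (τ i) := by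
  simp [append]

lemma append_bijective (n : ℕ) :
    Function.Bijective fun p : Fin (n + 1) × Equiv.Perm (Fin n) => append p.1 p.2 := by
  rw [Fintype.bijective_iff_injective_and_card]
  refine ⟨?_, by simp [Fintype.card_perm, Nat.factorial_succ]⟩
  rintro ⟨a, σ⟩ ⟨b, τ⟩ h
  have hab : a = b := by simpa using congrArg (fun f => f (Fin.last n)) h
  subst hab
  refine Prod.ext rfl (Equiv.ext fun i => ?_)
  simpa using congrArg (fun f => f i.castSucc) h

lemma sum_perm_succ {M : Type*} [AddCommMonoid M] {n : ℕ} (f : Equiv.Perm (Fin (n + 1)) → M) :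
    ∑ σ, f σ = ∑ τ : Equiv.Perm (Fin n), ∑ a : Fin (n + 1), f (append a τ) := by
  rw [← (append_bijective n).sum_comp f, Fintype.sum_prod_type, Finset.sum_comm]

lemma exists_append {n : ℕ} (σ : Equiv.Perm (Fin (n + 1))) : ∃ a τ, σ = append a τ := by
  obtain ⟨⟨a, τ⟩, h⟩ := (append_bijective n).2 σ
  exact ⟨a, τ, h.symm⟩

/-- The permutation obtained by deleting the last letter. -/
noncomputable def init {n : ℕ} (σ : Equiv.Perm (Fin (n + 1))) : Equiv.Perm (Fin n) :=
  (exists_append σ).choose_spec.choose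

@[simp] lemma init_append {n : ℕ} (a : Fin (n + 1)) (τ : Equiv.Perm (Fin n)) :
    init (append a τ) = τ := by
  have h := (exists_append (append a τ)).choose_spec.choose_spec
  exact (congrArg Prod.snd
    ((append_bijective n).1 (a₁ := (a, τ)) (a₂ := (_, _)) h)).symm

lemma append_lt_append {n : ℕ} (a : Fin (n + 1)) (τ : Equiv.Perm (Fin n)) (i j : Fin n) :
    append a τ i.castSucc < append a τ j.castSucc ↔ τ i < τ j := by
  simp

lemma append_castSucc_lt {n : ℕ} (a : Fin (n + 1)) (τ : Equiv.Perm (Fin n)) (i : Fin n) :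
    a.succAbove (τ i) < a ↔ (τ i : ℕ) < a := by
  rw [Fin.succAbove_lt_iff_castSucc_lt]; rfl

lemma lt_append_castSucc {n : ℕ} (a : Fin (n + 1)) (τ : Equiv.Perm (Fin n)) (i : Fin n) :
    a < a.succAbove (τ i) ↔ (a : ℕ) ≤ τ i := by
  rw [Fin.lt_succAbove_iff_le_castSucc]; rfl

lemma mem_avoiding_321 {n : ℕ} (σ : Equiv.Perm (Fin n)) :
    σ ∈ avoiding n ![3, 2, 1] ↔ ∀ i j k, i < j → j < k → σ k < σ j → ¬ σ j < σ i := by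
  rw [avoiding, Finset.mem_filter]
  simp only [Finset.mem_univ, true_and, IsOccurrence]
  constructor
  · intro h i j k hij hjk h1 h2
    refine h ![i, j, k] ⟨?_, ?_, ?_⟩
    · simp [Fin.forall_fin_succ, hij, hjk, hij.trans hjk]
    · simp [Fin.forall_fin_succ, h1, h2, h1.trans h2, h1.le, h2.le, (h1.trans h2).le]
    · simp
  · rintro h i ⟨h1, h2, -⟩
    exact h (i 0) (i 1) (i 2) (h1 _ _ (by decide)) (h1 _ _ (by decide))
      ((h2 _ _).2 (by decide)) ((h2 _ _).2 (by decide))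

lemma mem_avoiding_231 {n : ℕ} (σ : Equiv.Perm (Fin n)) :
    σ ∈ avoiding n ![2, 3, 1] ↔ ∀ i j k, i < j → j < k → σ k < σ i → ¬ σ i < σ j := by
  rw [avoiding, Finset.mem_filter]
  simp only [Finset.mem_univ, true_and, IsOccurrence]
  constructor
  · intro h i j k hij hjk h1 h2
    refine h ![i, j, k] ⟨?_, ?_, ?_⟩
    · simp [Fin.forall_fin_succ, hij, hjk, hij.trans hjk]
    · simp [Fin.forall_fin_succ, h1, h2, h1.trans h2, h1.le, h2.le, (h1.trans h2).le]
    · simp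
  · rintro h i ⟨h1, h2, -⟩
    exact h (i 0) (i 1) (i 2) (h1 _ _ (by decide)) (h1 _ _ (by decide))
      ((h2 _ _).2 (by decide)) ((h2 _ _).2 (by decide))

/-- A new occurrence must use the last letter, as the `1` of the pattern; the same holds for `231`.
-/
lemma append_mem_avoiding_321 {n : ℕ} (a : Fin (n + 1)) (τ : Equiv.Perm (Fin n)) :
    append a τ ∈ avoiding (n + 1) ![3, 2, 1] ↔ τ ∈ avoiding n ![3, 2, 1] ∧
      ∀ i j, i < j → (a : ℕ) ≤ τ j → τ i < τ j := by
  simp only [mem_avoiding_321]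
  constructor
  · refine fun h => ⟨fun i j k hij hjk h1 h2 => ?_, fun i j hij ha => ?_⟩
    · exact h i.castSucc j.castSucc k.castSucc hij hjk
        ((append_lt_append ..).2 h1) ((append_lt_append ..).2 h2)
    · have := h i.castSucc j.castSucc (Fin.last n) hij (Fin.castSucc_lt_last j)
        (by simpa [lt_append_castSucc] using ha)
      rw [append_lt_append, not_lt] at this
      exact lt_of_le_of_ne this fun e => hij.ne (τ.injective e)
  · rintro ⟨h, h'⟩ i j k hij hjk
    induction k using Fin.lastCases with
    | last =>
      obtain ⟨j, rfl⟩ := Fin.exists_castSucc_eq.2 hjk.ne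
      obtain ⟨i, rfl⟩ := Fin.exists_castSucc_eq.2 (hij.trans hjk).ne
      intro h1
      rw [append_last, append_castSucc, lt_append_castSucc] at h1
      rw [append_lt_append]
      exact (h' i j hij h1).le.not_gt
    | cast k =>
      obtain ⟨j, rfl⟩ := Fin.exists_castSucc_eq.2 (hjk.trans (Fin.castSucc_lt_last k)).ne
      obtain ⟨i, rfl⟩ := Fin.exists_castSucc_eq.2
        (hij.trans (hjk.trans (Fin.castSucc_lt_last k))).ne
      simpa using h i j k hij hjk

lemma append_mem_avoiding_231 {n : ℕ} (a : Fin (n + 1)) (τ : Equiv.Perm (Fin n)) :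
    append a τ ∈ avoiding (n + 1) ![2, 3, 1] ↔ τ ∈ avoiding n ![2, 3, 1] ∧
      ∀ i j, i < j → (a : ℕ) ≤ τ i → τ j < τ i := by
  simp only [mem_avoiding_231]
  constructor
  · refine fun h => ⟨fun i j k hij hjk h1 h2 => ?_, fun i j hij ha => ?_⟩
    · exact h i.castSucc j.castSucc k.castSucc hij hjk
        ((append_lt_append ..).2 h1) ((append_lt_append ..).2 h2)
    · have := h i.castSucc j.castSucc (Fin.last n) hij (Fin.castSucc_lt_last j)
        (by simpa [lt_append_castSucc] using ha)
      rw [append_lt_append, not_lt] at this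
      exact lt_of_le_of_ne this fun e => hij.ne' (τ.injective e)
  · rintro ⟨h, h'⟩ i j k hij hjk
    induction k using Fin.lastCases with
    | last =>
      obtain ⟨j, rfl⟩ := Fin.exists_castSucc_eq.2 hjk.ne
      obtain ⟨i, rfl⟩ := Fin.exists_castSucc_eq.2 (hij.trans hjk).ne
      intro h1
      rw [append_last, append_castSucc, lt_append_castSucc] at h1
      rw [append_lt_append]
      exact (h' i j hij h1).le.not_gt
    | cast k =>
      obtain ⟨j, rfl⟩ := Fin.exists_castSucc_eq.2 (hjk.trans (Fin.castSucc_lt_last k)).ne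
      obtain ⟨i, rfl⟩ := Fin.exists_castSucc_eq.2
        (hij.trans (hjk.trans (Fin.castSucc_lt_last k))).ne
      simpa using h i j k hij hjk

lemma coe_append_castSucc {n : ℕ} (a : Fin (n + 1)) (τ : Equiv.Perm (Fin n)) (i : Fin n) :
    (append a τ i.castSucc : ℕ) = if (τ i : ℕ) < a then (τ i : ℕ) else τ i + 1 := by
  rw [append_castSucc, Fin.succAbove]
  simp only [Fin.lt_def, Fin.val_castSucc]
  split_ifs <;> simp

lemma exists_castSucc_append_eq {n : ℕ} (a : Fin (n + 1)) (τ : Equiv.Perm (Fin n))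
    {b : Fin (n + 1)} (h : b ≠ a) : ∃ i : Fin n, append a τ i.castSucc = b := by
  obtain ⟨i, hi⟩ : ∃ i, i = (append a τ).symm b := ⟨_, rfl⟩
  induction i using Fin.lastCases with
  | last =>
    rw [Equiv.eq_symm_apply, append_last] at hi
    exact absurd hi.symm h
  | cast i => exact ⟨i, by rw [hi, Equiv.apply_symm_apply]⟩

/-- The admissible letters are always the topmost `l + 1` values, with `l` read off the state. -/
lemma sum_fin_ite_le {M : Type*} [AddCommMonoid M] {n l : ℕ} (h : l ≤ n) (g : ℕ → M) :
    ∑ a : Fin (n + 1), (if n ≤ (a : ℕ) + l then g a else 0)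
      = ∑ i ∈ Finset.range (l + 1), g (n - l + i) := by
  rw [Fin.sum_univ_eq_sum_range fun a => if n ≤ a + l then g a else 0]
  obtain ⟨k, rfl⟩ := Nat.exists_eq_add_of_le' h
  rw [add_assoc, Finset.sum_range_add, Finset.sum_eq_zero, zero_add, Nat.add_sub_cancel]
  · exact Finset.sum_congr rfl fun i _ => if_pos (by omega)
  · intro i hi
    rw [Finset.mem_range] at hi
    exact if_neg (by omega)

/-- `P` is required only for `τ ∈ T` because states describe admissible letters only for avoiders.
-/
lemma sum_mem_append {M : Type*} [AddCommMonoid M] {n : ℕ} (S : Finset (Equiv.Perm (Fin (n + 1))))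
    (T : Finset (Equiv.Perm (Fin n))) (P : Equiv.Perm (Fin n) → Fin (n + 1) → Prop)
    [∀ τ a, Decidable (P τ a)] (h : ∀ a τ, append a τ ∈ S ↔ τ ∈ T ∧ (τ ∈ T → P τ a))
    (f : Equiv.Perm (Fin (n + 1)) → M) :
    ∑ σ ∈ S, f σ = ∑ τ ∈ T, ∑ a, if P τ a then f (append a τ) else 0 := by
  have e {k : ℕ} (S : Finset (Equiv.Perm (Fin k))) (f : Equiv.Perm (Fin k) → M) :
      ∑ σ ∈ S, f σ = ∑ σ, if σ ∈ S then f σ else 0 := by simp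
  rw [e S, e T, sum_perm_succ]
  refine Finset.sum_congr rfl fun τ _ => ?_
  by_cases hτ : τ ∈ T <;> simp [h, hτ]

/-! ### Inversions and labels of `321`-avoiders. -/

lemma inv_eq_sum {n : ℕ} (σ : Equiv.Perm (Fin n)) :
    inv σ = ∑ j, ∑ i, if i < j ∧ σ j < σ i then 1 else 0 := by
  rw [inv, Finset.card_filter, Fintype.sum_prod_type_right]

lemma inv_append {n : ℕ} (a : Fin (n + 1)) (τ : Equiv.Perm (Fin n)) :
    inv (append a τ) = inv τ + (n - a) := by
  rw [inv_eq_sum, inv_eq_sum, Fin.sum_univ_castSucc]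
  simp only [Fin.sum_univ_castSucc, append_last, append_castSucc,
    lt_append_castSucc, Fin.castSucc_lt_castSucc_iff, Fin.castSucc_lt_last, lt_irrefl,
    (Fin.castSucc_lt_last _).not_gt, true_and, false_and, if_false, add_zero]
  simp only [← append_castSucc, append_lt_append]
  congr 1
  rw [Equiv.sum_comp τ fun v : Fin n => if (a : ℕ) ≤ v then 1 else 0,
    Fin.sum_univ_eq_sum_range fun v => if (a : ℕ) ≤ v then 1 else 0, ← Finset.card_filter]
  have : (Finset.range n).filter (fun v => (a : ℕ) ≤ v) = Finset.Ico (a : ℕ) n := by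
    ext v
    simp [and_comm]
  rw [this, Nat.card_Ico]

/-- The number of largest letters appearing in increasing order, for `321`-avoiding
permutations. -/
noncomputable def label : {n : ℕ} → Equiv.Perm (Fin n) → ℕ
  | 0, _ => 0
  | n + 1, σ => if σ (Fin.last n) = Fin.last n then label (init σ) + 1 else n - σ (Fin.last n)

lemma label_append {n : ℕ} (a : Fin (n + 1)) (τ : Equiv.Perm (Fin n)) :
    label (append a τ) = if (a : ℕ) = n then label τ + 1 else n - a := by
  simp [label, Fin.ext_iff]

lemma label_le {n : ℕ} (σ : Equiv.Perm (Fin n)) : label σ ≤ n := by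
  induction n with
  | zero => simp [label]
  | succ n ih =>
    obtain ⟨a, τ, rfl⟩ := exists_append σ
    have := ih τ
    rw [label_append]
    split_ifs <;> omega

/-- Appending the maximum prolongs the increasing top block. Any other `a` has a larger letter
before it, so the block is exactly the letters above `a`. -/
lemma increasing_iff_le_label {n : ℕ} {σ : Equiv.Perm (Fin n)} (hσ : σ ∈ avoiding n ![3, 2, 1])
    (b : ℕ) : (∀ i j, i < j → b ≤ σ j → σ i < σ j) ↔ n ≤ b + label σ := by
  induction n with
  | zero => simp
  | succ n ih =>
    obtain ⟨a, τ, rfl⟩ := exists_append σ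
    rw [append_mem_avoiding_321] at hσ
    rw [label_append]
    split_ifs with ha
    · rw [← add_assoc, Nat.add_le_add_iff_right, ← ih hσ.1]
      constructor
      · intro h i j hij hb
        rw [← append_lt_append a]
        refine h _ _ hij (hb.trans ?_)
        rw [coe_append_castSucc]
        split_ifs <;> omega
      · intro h i j hij hb
        obtain ⟨i, rfl⟩ := Fin.exists_castSucc_eq.2 (hij.trans_le j.le_last).ne
        induction j using Fin.lastCases with
        | last =>
          rw [Fin.lt_def, append_last, coe_append_castSucc]
          split_ifs <;> omega
        | cast j =>
          rw [append_lt_append]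
          refine h i j hij ?_
          rw [coe_append_castSucc] at hb
          split_ifs at hb <;> omega
    · constructor
      · intro h
        by_contra hb
        obtain ⟨i, hi⟩ := exists_castSucc_append_eq a τ (b := Fin.last n)
          (by rw [Ne, Fin.ext_iff, Fin.val_last]; omega)
        have := h i.castSucc (Fin.last n) (Fin.castSucc_lt_last i)
          (by rw [append_last]; omega)
        rw [hi] at this
        exact (Fin.le_last _).not_gt this
      · intro hb i j hij hj
        induction j using Fin.lastCases with
        | last => rw [append_last] at hj; omega
        | cast j =>
          obtain ⟨i, rfl⟩ := Fin.exists_castSucc_eq.2 (hij.trans (Fin.castSucc_lt_last j)).ne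
          rw [append_lt_append]
          refine hσ.2 i j hij ?_
          rw [coe_append_castSucc] at hj
          split_ifs at hj <;> omega

section

variable {R : Type*} [CommRing R] (q : R)

/-- Trades the last letter of the permutation for one step of the tree; iterating empties the
permutation. -/
lemma sum_inv_labelSum_succ (n m : ℕ) :
    ∑ σ ∈ avoiding (n + 1) ![3, 2, 1], q ^ inv σ * labelSum q m (label σ)
      = ∑ σ ∈ avoiding n ![3, 2, 1], q ^ inv σ * labelSum q (m + 1) (label σ) := by
  rw [sum_mem_append _ (avoiding n ![3, 2, 1]) (fun τ a => n ≤ (a : ℕ) + label τ)]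
  · refine Finset.sum_congr rfl fun τ _ => ?_
    have hl := label_le τ
    simp only [inv_append, label_append]
    -- The top site `a = n` gives the child `l + 1`. The others are reflected, since the child `j`
    -- comes from `a = n - j`.
    rw [sum_fin_ite_le hl fun a => q ^ (inv τ + (n - a)) *
      labelSum q m (if a = n then label τ + 1 else n - a), Finset.sum_range_succ, labelSum,
      ← Finset.sum_range_reflect, mul_add, add_comm, Finset.mul_sum]
    congr 1
    · simp [Nat.sub_add_cancel hl]
    · refine Finset.sum_congr rfl fun i hi => ?_
      rw [Finset.mem_range] at hi
      rw [if_neg (by omega), pow_add, mul_assoc,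
        show n - (n - label τ + (label τ - 1 - i)) = i + 1 by omega]
  · intro a τ
    rw [append_mem_avoiding_321]
    exact and_congr_right fun hτ => by
      rw [increasing_iff_le_label hτ, forall_prop_of_true hτ]

theorem sum_inv_eq_labelSum (n : ℕ) :
    ∑ σ ∈ avoiding n ![3, 2, 1], q ^ inv σ = labelSum q n 0 := by
  have h (k m : ℕ) : ∑ σ ∈ avoiding k ![3, 2, 1], q ^ inv σ * labelSum q m (label σ)
      = labelSum q (m + k) 0 := by
    induction k generalizing m with
    | zero =>
      have : avoiding 0 ![3, 2, 1] = Finset.univ := by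
        ext σ
        simp only [mem_avoiding_321, Finset.mem_univ, iff_true]
        exact fun i => i.elim0
      rw [this]
      simp [label, inv]
    | succ k ih => rw [sum_inv_labelSum_succ, ih, add_assoc, add_comm 1]
  simpa [labelSum] using h n 0

end

/-! ### `mad` and run lists of `231`-avoiders. -/

lemma occ_231_eq_zero {n : ℕ} {σ : Equiv.Perm (Fin n)} (h : σ ∈ avoiding n ![2, 3, 1]) :
    occ ![2, 3, 1] {2} σ = 0 := by
  rw [occ, Finset.card_eq_zero, Finset.filter_eq_empty_iff]
  rintro i - ⟨h1, h2, -⟩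
  rw [avoiding, Finset.mem_filter] at h
  exact h.2 i ⟨h1, h2, by simp⟩

lemma occ_21_eq_sum {n : ℕ} (σ : Equiv.Perm (Fin n)) :
    occ ![2, 1] {1} σ
      = ∑ p : Fin n, ∑ r : Fin n, if (r : ℕ) = p + 1 ∧ σ r < σ p then 1 else 0 := by
  rw [occ, ← Fintype.sum_prod_type' (f := fun p r : Fin n =>
    if (r : ℕ) = p + 1 ∧ σ r < σ p then 1 else 0), ← Finset.card_filter]
  refine Finset.card_bij' (fun i _ => (i 0, i 1)) (fun x _ => ![x.1, x.2]) ?_ ?_ ?_ ?_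
  · intro i hi
    obtain ⟨-, h2, h3⟩ := (Finset.mem_filter.1 hi).2
    simpa using ⟨h3 0 1 (by decide) (by decide), (h2 1 0).2 (by decide)⟩
  · rintro ⟨p, r⟩ hx
    obtain ⟨h1, h2⟩ := (Finset.mem_filter.1 hx).2
    dsimp only at h1 h2
    have h3 : p < r := by rw [Fin.lt_def]; omega
    simp [IsOccurrence, Fin.forall_fin_succ, h1, h2, h2.le, h3]
  · intro i _
    ext j
    fin_cases j <;> rfl
  · intro x _
    rfl

lemma occ_312_eq_sum {n : ℕ} (σ : Equiv.Perm (Fin n)) :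
    occ ![3, 1, 2] {1} σ = ∑ k : Fin n, ∑ p : Fin n, ∑ r : Fin n,
      if (r : ℕ) = p + 1 ∧ r < k ∧ σ r < σ k ∧ σ k < σ p then 1 else 0 := by
  simp_rw [← Fintype.sum_prod_type']
  rw [occ, ← Finset.card_filter]
  refine Finset.card_bij' (fun i _ => (i 2, i 0, i 1)) (fun x _ => ![x.2.1, x.2.2, x.1])
    ?_ ?_ ?_ ?_
  · intro i hi
    obtain ⟨h1, h2, h3⟩ := (Finset.mem_filter.1 hi).2
    simpa using ⟨h3 0 1 (by decide) (by decide), h1 1 2 (by decide), (h2 1 2).2 (by decide),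
      (h2 2 0).2 (by decide)⟩
  · rintro ⟨k, p, r⟩ hx
    obtain ⟨h1, h2, h3, h4⟩ := (Finset.mem_filter.1 hx).2
    dsimp only at h1 h2 h3 h4
    have h5 : p < r := by rw [Fin.lt_def]; omega
    simp [IsOccurrence, Fin.forall_fin_succ, h1, h2, h3, h4, h5, h5.trans h2, h3.le, h4.le,
      h3.trans h4, (h3.trans h4).le]
  · intro i _
    ext j
    fin_cases j <;> rfl
  · intro x _
    rfl

/-- The number of descents from a letter `≥ b` to a letter `< b`. -/
def straddles {n : ℕ} (τ : Equiv.Perm (Fin n)) (b : ℕ) : ℕ :=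
  ∑ p : Fin n, ∑ r : Fin n, if (r : ℕ) = (p : ℕ) + 1 ∧ (τ r : ℕ) < b ∧ b ≤ τ p then 1 else 0

/-- `1` if the last letter is `≥ b`, and `0` otherwise. -/
def lastGe {n : ℕ} (τ : Equiv.Perm (Fin n)) (b : ℕ) : ℕ :=
  ∑ p : Fin n, if n = (p : ℕ) + 1 ∧ b ≤ τ p then 1 else 0

lemma occ_21_append {n : ℕ} (a : Fin (n + 1)) (τ : Equiv.Perm (Fin n)) :
    occ ![2, 1] {1} (append a τ) = occ ![2, 1] {1} τ + lastGe τ a := by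
  have (i : Fin n) : (i : ℕ) ≠ n + 1 := by omega
  rw [occ_21_eq_sum, occ_21_eq_sum]
  simp only [Fin.sum_univ_castSucc, append_last, append_castSucc,
    lt_append_castSucc, Fin.val_castSucc, Fin.val_last, this, lt_irrefl, and_false, false_and,
    if_false, add_zero, Finset.sum_const_zero, Finset.sum_add_distrib]
  simp only [← append_castSucc, append_lt_append]
  rfl

lemma occ_312_append {n : ℕ} (a : Fin (n + 1)) (τ : Equiv.Perm (Fin n)) :
    occ ![3, 1, 2] {1} (append a τ) = occ ![3, 1, 2] {1} τ + straddles τ a := by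
  have (i : Fin n) : (i : ℕ) ≠ n + 1 := by omega
  rw [occ_312_eq_sum, occ_312_eq_sum]
  simp only [Fin.sum_univ_castSucc, append_last, append_castSucc,
    lt_append_castSucc, append_castSucc_lt, Fin.val_castSucc, Fin.val_last, this, lt_irrefl,
    and_false, false_and, (Fin.castSucc_lt_last _).not_gt, Fin.castSucc_lt_last, true_and,
    Fin.castSucc_lt_castSucc_iff,
    if_false, add_zero, Finset.sum_const_zero, Finset.sum_add_distrib]
  simp only [← append_castSucc, append_lt_append]
  rfl

/-- The new letter `a` closes a `31-2` for each descent across level `a`, and a descent if the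
previous letter is `≥ a`. Together these count the runs of letters `≥ a`, each ended by such a
descent or by the end of the word. -/
lemma mad_append {n : ℕ} {a : Fin (n + 1)} {τ : Equiv.Perm (Fin n)}
    (h : append a τ ∈ avoiding (n + 1) ![2, 3, 1]) :
    mad (append a τ) = mad τ + (straddles τ a + lastGe τ a) := by
  have h' := ((append_mem_avoiding_231 a τ).1 h).1
  rw [mad, mad, occ_231_eq_zero h, occ_231_eq_zero h', occ_21_append, occ_312_append]
  ring

lemma straddles_append_self {n : ℕ} (a : Fin (n + 1)) (τ : Equiv.Perm (Fin n)) :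
    straddles (append a τ) a = straddles τ a := by
  have (i : Fin n) : (i : ℕ) ≠ n + 1 := by omega
  have h1 (i : Fin n) : (append a τ i.castSucc : ℕ) < a ↔ (τ i : ℕ) < a := by
    rw [coe_append_castSucc]; split_ifs <;> omega
  have h2 (i : Fin n) : (a : ℕ) ≤ append a τ i.castSucc ↔ (a : ℕ) ≤ τ i := by
    rw [coe_append_castSucc]; split_ifs <;> omega
  simp only [straddles, Fin.sum_univ_castSucc, append_last, h1, h2, this, Fin.val_castSucc,
    Fin.val_last, and_false, false_and, if_false, add_zero, Finset.sum_const_zero, lt_irrefl]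

/-- Old letters `≥ c` become those `≥ c + 1`, and the appended `a` ends a run that reached the last
position. -/
lemma straddles_append_succ {n : ℕ} (a : Fin (n + 1)) (τ : Equiv.Perm (Fin n)) {c : ℕ}
    (hc : a ≤ c) : straddles (append a τ) (c + 1) = straddles τ c + lastGe τ c := by
  have (i : Fin n) : (i : ℕ) ≠ n + 1 := by omega
  have h1 (i : Fin n) : (append a τ i.castSucc : ℕ) < c + 1 ↔ (τ i : ℕ) < c := by
    rw [coe_append_castSucc]; split_ifs <;> omega
  have h2 (i : Fin n) : c + 1 ≤ append a τ i.castSucc ↔ c ≤ τ i := by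
    rw [coe_append_castSucc]; split_ifs <;> omega
  have h3 : (a : ℕ) < c + 1 := by omega
  simp only [straddles, lastGe, Fin.sum_univ_castSucc, append_last, h1, h2, h3, this,
    Fin.val_castSucc, Fin.val_last, and_false, true_and, if_false, add_zero,
    Finset.sum_const_zero, Finset.sum_add_distrib, h3.not_ge]

lemma lastGe_append {n : ℕ} (a : Fin (n + 1)) (τ : Equiv.Perm (Fin n)) (b : ℕ) :
    lastGe (append a τ) b = if b ≤ a then 1 else 0 := by
  have (i : Fin n) : n + 1 ≠ i + 1 := by omega
  simp only [lastGe, Fin.sum_univ_castSucc, append_last, this, Fin.val_castSucc, Fin.val_last,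
    false_and, true_and, if_false, Finset.sum_const_zero, zero_add]

/-- For a `231`-avoiding permutation whose `k` largest letters appear in decreasing order, `k`
being maximal, the list of the numbers of runs of consecutive positions formed by the `k`, `k - 1`,
…, `1` largest letters. -/
noncomputable def runList : {n : ℕ} → Equiv.Perm (Fin n) → List ℕ
  | 0, _ => []
  | n + 1, σ =>
    let L := (runList (init σ)).drop ((σ (Fin.last n) : ℕ) + (runList (init σ)).length - n)
    (if (σ (Fin.last n) : ℕ) + (runList (init σ)).length - n = 0 then L.headD 1
      else L.headD 0 + 1) :: L

lemma runList_append {n : ℕ} (a : Fin (n + 1)) (τ : Equiv.Perm (Fin n)) {i : ℕ}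
    (hi : (a : ℕ) + (runList τ).length = n + i) :
    runList (append a τ) = (if i = 0 then (runList τ).headD 1
      else ((runList τ).drop i).headD 0 + 1) :: (runList τ).drop i := by
  obtain rfl : i = (a : ℕ) + (runList τ).length - n := by omega
  simp only [runList, append_last, init_append]
  split_ifs with h <;> simp [h]

lemma length_runList_le {n : ℕ} (σ : Equiv.Perm (Fin n)) : (runList σ).length ≤ n := by
  induction n with
  | zero => simp [runList]
  | succ n ih =>
    have := ih (init σ)
    simp only [runList, List.length_cons, List.length_drop]
    omega

/-- One induction carries the admissible sites, the shape of the state, the run counts, and the fact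
that the last letter is the least of the decreasing top letters. The last item decides whether a new
letter joins the final run (`i = 0`) or opens a new one (`i > 0`). -/
lemma runList_spec {n : ℕ} {σ : Equiv.Perm (Fin n)} (hσ : σ ∈ avoiding n ![2, 3, 1]) :
    (∀ b : ℕ, (∀ i j, i < j → b ≤ σ i → σ j < σ i) ↔ n ≤ b + (runList σ).length) ∧
    IsState (runList σ) ∧
    (∀ i b : ℕ, i ≤ (runList σ).length → b + (runList σ).length = n + i →
      straddles σ b + lastGe σ b = ((runList σ).drop i).headD 0) ∧
    (∀ b : ℕ, lastGe σ b = if b + (runList σ).length ≤ n ∧ 0 < n then 1 else 0) := by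
  induction n with
  | zero => simp [runList, IsState.nil, straddles, lastGe]
  | succ n ih =>
    obtain ⟨a, τ, rfl⟩ := exists_append σ
    rw [append_mem_avoiding_231] at hσ
    obtain ⟨h1, h2, h3, h4⟩ := ih hσ.1
    have hle := length_runList_le τ
    obtain ⟨i₀, hi₀⟩ := Nat.exists_eq_add_of_le ((h1 a).1 hσ.2)
    have hR := runList_append a τ hi₀
    have hlen : (runList (append a τ)).length + a = n + 1 := by
      rw [hR, List.length_cons, List.length_drop]
      omega
    refine ⟨fun b => ⟨fun h => ?_, fun hb i j hij hi => ?_⟩, ?_, ?_, fun b => ?_⟩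
    · by_contra hb
      -- A letter `b < a` stands before the final, larger `a`.
      obtain ⟨i, hi⟩ := exists_castSucc_append_eq a τ (b := ⟨b, by omega⟩)
        (by rw [Ne, Fin.ext_iff]; dsimp only; omega)
      have := h i.castSucc (Fin.last n) (Fin.castSucc_lt_last i) (by rw [hi])
      rw [hi, append_last, Fin.lt_def] at this
      dsimp only at this
      omega
    · obtain ⟨i, rfl⟩ := Fin.exists_castSucc_eq.2 (hij.trans_le j.le_last).ne
      have hi' : (a : ℕ) ≤ τ i := by
        rw [coe_append_castSucc] at hi
        split_ifs at hi <;> omega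
      induction j using Fin.lastCases with
      | last => rw [append_last, append_castSucc, lt_append_castSucc]; exact hi'
      | cast j => rw [append_lt_append]; exact hσ.2 i j hij hi'
    · rw [hR]
      split_ifs with h
      · rw [h, List.drop_zero]
        exact h2.repeat_head
      · exact (h2.drop i₀).succ_head
    · rintro (_ | i) b hi hb
      · obtain rfl : b = a := by omega
        rw [straddles_append_self, lastGe_append, if_pos le_rfl, hR, List.drop_zero,
          List.headD_cons]
        have h5 := h3 i₀ a (by omega) hi₀
        rw [h4] at h5
        split_ifs with h
        · subst h
          rw [List.drop_zero] at h5
          -- With an empty list there is no run to join: the new letter forms the first one, whence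
          -- the default `1` of `headD`.
          rcases hL : runList τ with _ | ⟨r, L⟩
          · rw [hL] at h5
            simp only [List.headD_nil] at h5 ⊢
            omega
          · rw [hL] at h5 hi₀
            rw [hL, List.length_cons] at hle
            rwa [List.headD_cons, if_pos ⟨by omega, by omega⟩] at h5
        · rw [if_neg (by omega)] at h5
          rw [← h5, add_zero]
      · obtain ⟨c, rfl⟩ := Nat.exists_eq_add_of_le' (show 1 ≤ b by omega)
        rw [straddles_append_succ a τ (by omega), lastGe_append, if_neg (by omega), add_zero, hR,
          List.drop_succ_cons, List.drop_drop]
        exact h3 (i₀ + i) c (by omega) (by omega)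
    · rw [lastGe_append]
      exact if_congr (by omega) rfl rfl

/-! ### Summation over the `231`-avoiding tree and conclusion. -/

section

variable {R : Type*} [CommRing R] (q : R)

lemma sum_mad_stackSum_succ (n m : ℕ) :
    ∑ σ ∈ avoiding (n + 1) ![2, 3, 1], q ^ mad σ * stackSum q m (runList σ)
      = ∑ σ ∈ avoiding n ![2, 3, 1], q ^ mad σ * stackSum q (m + 1) (runList σ) := by
  have hmem (a : Fin (n + 1)) (τ : Equiv.Perm (Fin n)) :
      append a τ ∈ avoiding (n + 1) ![2, 3, 1] ↔ τ ∈ avoiding n ![2, 3, 1] ∧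
        (τ ∈ avoiding n ![2, 3, 1] → n ≤ (a : ℕ) + (runList τ).length) := by
    rw [append_mem_avoiding_231]
    exact and_congr_right fun hτ => by rw [(runList_spec hτ).1, forall_prop_of_true hτ]
  rw [sum_mem_append _ _ _ hmem]
  refine Finset.sum_congr rfl fun τ hτ => ?_
  have hl := length_runList_le τ
  -- The summand as a function of a natural number `a`, with the dropped length `i` written `a + k -
  -- n`, where `k` is the length of the run list.
  obtain ⟨g, hg⟩ : ∃ g : ℕ → R, ∀ a, g a = q ^ mad τ *
      (q ^ ((runList τ).drop (a + (runList τ).length - n)).headD 0 *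
        stackSum q m ((if a + (runList τ).length - n = 0 then (runList τ).headD 1
          else ((runList τ).drop (a + (runList τ).length - n)).headD 0 + 1) ::
            (runList τ).drop (a + (runList τ).length - n))) := ⟨_, fun _ => rfl⟩
  have key (a : Fin (n + 1)) : (if n ≤ (a : ℕ) + (runList τ).length then
      q ^ mad (append a τ) * stackSum q m (runList (append a τ)) else 0)
      = if n ≤ (a : ℕ) + (runList τ).length then g a else 0 := by
    split_ifs with h
    · obtain ⟨i, hi⟩ := Nat.exists_eq_add_of_le h
      rw [mad_append ((hmem a τ).2 ⟨hτ, fun _ => h⟩), runList_append a τ hi,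
        (runList_spec hτ).2.2.1 i a (by omega) hi]
      simp only [hg, hi, Nat.add_sub_cancel_left, pow_add, mul_assoc]
    · rfl
  simp only [key]
  rw [sum_fin_ite_le hl, Finset.sum_range_succ', stackSum, mul_add, add_comm, Finset.mul_sum]
  have e (i : ℕ) : n - (runList τ).length + i + (runList τ).length - n = i := by omega
  simp only [hg, e]
  simp

theorem sum_mad_eq_stackSum (n : ℕ) :
    ∑ σ ∈ avoiding n ![2, 3, 1], q ^ mad σ = stackSum q n [] := by
  have h (k m : ℕ) : ∑ σ ∈ avoiding k ![2, 3, 1], q ^ mad σ * stackSum q m (runList σ)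
      = stackSum q (m + k) [] := by
    induction k generalizing m with
    | zero =>
      have : avoiding 0 ![2, 3, 1] = Finset.univ := by
        ext σ
        simp only [mem_avoiding_231, Finset.mem_univ, iff_true]
        exact fun i => i.elim0
      rw [this]
      simp [runList, mad, occ_21_eq_sum, occ_312_eq_sum,
        occ_231_eq_zero (this ▸ Finset.mem_univ (1 : Equiv.Perm (Fin 0)))]
    | succ k ih => rw [sum_mad_stackSum_succ, ih, add_assoc, add_comm 1]
  simpa [stackSum] using h n 0

end

theorem sum_mad_eq_sum_inv (n : ℕ) :
    ∑ σ ∈ avoiding n ![2, 3, 1], (X : ℕ[X]) ^ mad σ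
      = ∑ σ ∈ avoiding n ![3, 2, 1], (X : ℕ[X]) ^ inv σ := by
  -- The series argument subtracts, so it needs coefficients in a ring.
  apply Polynomial.map_injective (Nat.castRingHom ℤ) Nat.cast_injective
  simp only [Polynomial.map_sum, Polynomial.map_pow, Polynomial.map_X]
  rw [sum_mad_eq_stackSum, sum_inv_eq_labelSum, stackSum_nil_eq_labelSum_zero]

/-- Two statistics with the same generating polynomial are transported by a bijection. -/
lemma exists_bijOn_of_sum_X_pow_eq {α : Type*} [DecidableEq α] [Inhabited α] {A B : Finset α}
    {f g : α → ℕ} (h : ∑ x ∈ B, (X : ℕ[X]) ^ g x = ∑ x ∈ A, (X : ℕ[X]) ^ f x) :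
    ∃ φ : α → α, Set.BijOn φ A B ∧ ∀ x ∈ A, g (φ x) = f x := by
  have hcard (m : ℕ) : (A.filter (f · = m)).card = (B.filter (g · = m)).card := by
    have := congrArg (fun p => Polynomial.coeff p m) h
    simp only [Polynomial.finsetSum_coeff, Polynomial.coeff_X_pow] at this
    simp only [Finset.card_filter, eq_comm (b := m)]
    exact this.symm
  let e (m : ℕ) := Finset.equivOfCardEq (hcard m)
  have he (x : α) (hx : x ∈ A) : x ∈ A.filter (f · = f x) := by simp [hx]
  have he' (x : α) (hx : x ∈ B) : x ∈ B.filter (g · = g x) := by simp [hx]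
  let φ (x : α) : α := if hx : x ∈ A then e (f x) ⟨x, he x hx⟩ else x
  have hφ (x : α) (hx : x ∈ A) : φ x = e (f x) ⟨x, he x hx⟩ := dif_pos hx
  have hmem (x : α) (hx : x ∈ A) : φ x ∈ B ∧ g (φ x) = f x := by
    rw [hφ x hx]
    exact Finset.mem_filter.1 (e (f x) ⟨x, he x hx⟩).2
  refine ⟨φ, ⟨fun x hx => (hmem x hx).1, fun x hx y hy hxy => ?_, fun y hy => ?_⟩,
    fun x hx => (hmem x hx).2⟩
  · have hf : f x = f y := by rw [← (hmem x hx).2, ← (hmem y hy).2, hxy]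
    rw [hφ x hx, hφ y hy] at hxy
    -- Stated for a free `m`, so that the equality of fibre indices can be substituted inside the
    -- dependent equivalence `e`.
    have key : ∀ m (h1 : x ∈ A.filter (f · = m)) (h2 : y ∈ A.filter (f · = m)),
        (e m ⟨x, h1⟩ : α) = e m ⟨y, h2⟩ → x = y := fun m h1 h2 h3 =>
      congrArg Subtype.val ((e m).injective (Subtype.ext h3))
    generalize_proofs at hxy
    generalize f x = m at *
    subst hf
    exact key _ _ _ hxy
  · obtain ⟨x, hx⟩ : ∃ x, x = (e (g y)).symm ⟨y, he' y hy⟩ := ⟨_, rfl⟩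
    have hxA := Finset.mem_filter.1 x.2
    refine ⟨x, hxA.1, ?_⟩
    rw [hφ x hxA.1]
    have key : ∀ m (hm : m = g y) (h1 : (x : α) ∈ A.filter (f · = m)),
        (e m ⟨x, h1⟩ : α) = y := by
      rintro m rfl h1
      have : (⟨x, h1⟩ : {z // z ∈ A.filter (f · = g y)}) = (e (g y)).symm ⟨y, he' y hy⟩ := hx
      rw [this, Equiv.apply_symm_apply]
    exact key _ hxA.2 _

end PatternStat

theorem mainTheorem1 (n : ℕ) :
    (∑ σ ∈ PatternStat.avoiding n ![2, 3, 1], (X : ℕ[X]) ^ PatternStat.mad σ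
      = ∑ σ ∈ PatternStat.avoiding n ![3, 2, 1], (X : ℕ[X]) ^ PatternStat.inv σ) ∧
    (∃ φ : Equiv.Perm (Fin n) → Equiv.Perm (Fin n),
      Set.BijOn φ (PatternStat.avoiding n ![3, 2, 1]) (PatternStat.avoiding n ![2, 3, 1]) ∧
      ∀ σ ∈ PatternStat.avoiding n ![3, 2, 1], PatternStat.mad (φ σ) = PatternStat.inv σ) :=
  ⟨PatternStat.sum_mad_eq_sum_inv n,
    PatternStat.exists_bijOn_of_sum_X_pow_eq (PatternStat.sum_mad_eq_sum_inv n)⟩
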